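/- **Setting.** Fix $N\in\mathbb N$. A *mode tree* over $[N]=\{1,\dots,N\}$ is a full binary tree whose nodes are labelled by subsets of $[N]$: the root is $[N]$, the leaves are the singletons, and every interior (non-leaf) node is the disjoint union of its two children. The *hierarchical decomposition* over a mode tree $T$ with $s_\nu$ tensors at each node $\nu$ generates tensors $A\in\mathbb R^{M\times\cdots\times M}$ of order $N$ as follows. At each leaf $\{i\}$ there are vectors $\phi^{\{i\},\gamma}\in\mathbb R^M$, $\gamma\le s_{\{i\}}$; at each interior node $\nu$ with children $p,q$, $$\phi^{\nu,\gamma}=\Big(\sum_{\alpha\le s_p} W^{\nu,p}_{\gamma\alpha}\,\phi^{p,\alpha}\Big)\otimes\Big(\sum_{\alpha\le s_q} W^{\nu,q}_{\gamma\alpha}\,\phi^{q,\alpha}\Big),\qquad \gamma\le s_\nu ,$$ with the modes arranged in their natural order; and $A=\sum_{\gamma} o_\gamma\,\phi^{[N],\gamma}$. The leaf vectors, the weights $W$ and the output weights $o$ are arbitrary real parameters. The number of intermediate tensors is $\mathrm{size}(T,s)=\sum_{\nu\text{ interior}} s_\nu$. The *mixed decomposition* of $T_1$ and $T_2$ with $r$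 tensors at each node of each tree runs the two hierarchical decompositions in parallel, with separate parameters. For each interior node $\nu$ common to both trees a set $E_\nu\subseteq\{1,\dots,r\}$ with $2|E_\nu|\le r$ is fixed (possibly empty, so that the choice of the nodes at which an exchange takes place is included); once both decompositions have computed their tensors at $\nu$, the tensors with index $\gamma\in E_\nu$ are exchanged between them, before being used further up. The output is $A=\sum_\gamma o_{1,\gamma}\phi_1^{[N],\gamma}+\sum_\gamma o_{2,\gamma}\phi_2^{[N],\gamma}$. Its number of intermediate tensors is $\mathrm{size}_{\rm mix}(r)=\mathrm{size}(T_1,r)+\mathrm{size}(T_2,r)$. **Theorem (mode trees).** For every $N$ there is a constant $c>0$, depending only on $N$, such that the following holds. Let $T_1,T_2$ be mode trees over $[N]$ that are different, and not merely by the position of the root; that is, the families of bipartitions $\{\nu,[N]\setminus\nu\}$ of $[N]$ cut out by their nodes $\nu$ are different. (For perfect binary trees this just means $T_1\ne T_2$.) For all $r\le M$ and every choice of the exchange sets $E_\nu$ as above, there is a tensor $A$ generated by the mixed decomposition of $T_1$ and $T_2$ with $r$ tensors at each node of each tree, such that whenever $A$ is generated by the hierarchical decomposition over $T$ with $s_\nu$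 tensors at each node $\nu$, for $T=T_1$ or $T=T_2$ and any numbers $s_\nu$, then $$\mathrm{size}(T,s)\;\ge\;c\cdot \mathrm{size}_{\rm mix}(r)^2 .$$ **Corollary (dilated convolutional networks).** A dilated convolutional network with $d$ input channels, $L$ hidden layers of widths $w_1,\dots,w_L$ and dilations $\delta_1,\dots,\delta_L$ maps a sequence $x:\mathbb Z\to\mathbb R^d$ to the sequence $y[t]=\langle o,h_L[t]\rangle$, where $h_0=x$ and $$h_l[t]_\gamma=\langle a_{l,\gamma},h_{l-1}[t-\delta_l]\rangle\cdot\langle b_{l,\gamma},h_{l-1}[t]\rangle ,\qquad \gamma\le w_l,$$ with real weights $a,b,o$ that do not depend on $t$. The dilations $\delta_1,\dots,\delta_L$ are assumed to be $1,2,4,\dots,2^{L-1}$ in some order. Two networks $\mathcal N_1,\mathcal N_2$ with dilations $\delta^1,\delta^2$ and $r$ channels in each hidden layer, fed with the same input, are *interconnected* by exchanging between them, after the computation of each hidden layer $l$, the channels with index in a given set $E_l\subseteq\{1,\dots,r\}$, $2|E_l|\le r$ (possibly empty); the output of the resulting network $\mathcal M$ is the sum of the linear outputs of both networks. For every $L$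 there is a constant $c>0$, depending only on $L$, such that for any two different orders $\delta^1\neq\delta^2$ of the dilations, all $r\le d$ and all exchange sets $E_l$, the network $\mathcal M$ realizes a function that can be realized by a network with dilations $\delta^1$, or by one with dilations $\delta^2$, with $d$ input channels and hidden layers of widths $w_1,\dots,w_L$, only if $$w_1+\cdots+w_L\;\ge\;c\cdot(2Lr)^2,$$ where $2Lr$ is the total number of hidden channels of $\mathcal M$. -/

import Mathlib

/-! ### Hierarchical tensor decompositions over mode trees -/

/-- A full binary tree over the tensor modes `Fin N`. Every node is identified with the set of modes
(leaves) below it: the root is the set of all modes, the leaves are the singletons, any two nodes are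
nested or disjoint, and every node that is not a leaf is the disjoint union of two nodes. -/
@[ext]
structure ModeTree (N : ℕ) where
  nodes : Finset (Finset (Fin N))
  nonempty_of_mem : ∀ ν ∈ nodes, ν.Nonempty
  root_mem : Finset.univ ∈ nodes
  leaf_mem : ∀ i : Fin N, {i} ∈ nodes
  laminar : ∀ μ ∈ nodes, ∀ ν ∈ nodes, μ ⊆ ν ∨ ν ⊆ μ ∨ Disjoint μ ν
  exists_children : ∀ ν ∈ nodes, 1 < ν.card →
    ∃ p ∈ nodes, ∃ q ∈ nodes, Disjoint p q ∧ p ∪ q = ν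

namespace ModeTree

variable {N : ℕ}

/-- The interior (non-leaf) nodes. -/
def interior (T : ModeTree N) : Finset (Finset (Fin N)) :=
  T.nodes.filter fun ν => 1 < ν.card

/-- `p` and `q` are the two children of the node `ν`. -/
def IsChildren (T : ModeTree N) (ν p q : Finset (Fin N)) : Prop :=
  ν ∈ T.nodes ∧ p ∈ T.nodes ∧ q ∈ T.nodes ∧ Disjoint p q ∧ p ∪ q = ν

/-- The bipartitions `{ν, νᶜ}` of the modes cut out by the nodes of `T`, recorded through both of
their sides. Together they determine the tree up to the position of its root. -/
def bipartitions (T : ModeTree N) : Finset (Finset (Fin N)) :=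
  T.nodes ∪ T.nodes.image fun ν => νᶜ

end ModeTree

/-- Real tensors of order `N` with all modes of length `M`. An intermediate tensor attached to a node
`ν` of a tree, which has order `ν.card`, is recorded as a function of the full index `d` that reads
only the coordinates in `ν`; the outer product of tensors over disjoint sets of modes (followed by
the rearrangement of the modes) is then the pointwise product. -/
abbrev GridTensor (N M : ℕ) : Type := (Fin N → Fin M) → ℝ

/-- One step of a hierarchical decomposition: the `γ`-th tensor at a node with children `p`, `q` is
the outer product of a linear combination of the tensors at `p` and one of the tensors at `q`. -/
def outerStep {N M : ℕ} {s : Finset (Fin N) → ℕ} {k : ℕ}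
    (φ : ∀ ν, Fin (s ν) → GridTensor N M) (p q : Finset (Fin N))
    (a : Fin k → Fin (s p) → ℝ) (b : Fin k → Fin (s q) → ℝ) (γ : Fin k) : GridTensor N M :=
  fun d => (∑ α, a γ α * φ p α d) * ∑ α, b γ α * φ q α d

/-- The tensors generated by the hierarchical decomposition over the tree `T` that holds `s ν`
intermediate tensors at each node `ν`. The parameters are the vectors `u` at the leaves, the weights
`W` (where `W ν p` is used by the node `ν` to combine the tensors at its child `p`), and the
output weights `o`. -/
def treeTensors {N : ℕ} (T : ModeTree N) (s : Finset (Fin N) → ℕ) (M : ℕ) :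
    Set (GridTensor N M) :=
  {A | ∃ (u : ∀ i : Fin N, Fin (s {i}) → Fin M → ℝ)
      (W : ∀ ν p : Finset (Fin N), Fin (s ν) → Fin (s p) → ℝ)
      (o : Fin (s Finset.univ) → ℝ)
      (φ : ∀ ν, Fin (s ν) → GridTensor N M),
    (∀ i γ d, φ {i} γ d = u i γ (d i)) ∧
    (∀ ν p q, T.IsChildren ν p q → ∀ γ, φ ν γ = outerStep φ p q (W ν p) (W ν q) γ) ∧
    ∀ d, A d = ∑ γ, o γ * φ Finset.univ γ d}

/-- The number of intermediate tensors in the decomposition over `T` with `s ν` tensors at `ν`. -/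
def treeSize {N : ℕ} (T : ModeTree N) (s : Finset (Fin N) → ℕ) : ℕ :=
  ∑ ν ∈ T.interior, s ν

/-- The tensors generated by the mixed decomposition of `T₁` and `T₂` with `r` tensors at each node
of each tree. The two hierarchical decompositions run in parallel; `ψ₁ ν`, `ψ₂ ν` are the tensors
they compute at the node `ν`. At an interior node `ν` common to both trees, the tensors with index
in `E ν` are exchanged between the decompositions (`E ν = ∅` means no exchange at `ν`);
`φ₁ ν`, `φ₂ ν` are the tensors held after the exchange and used further up. -/
def mixedTensors {N : ℕ} (T₁ T₂ : ModeTree N) (r : ℕ) (E : Finset (Fin N) → Finset (Fin r))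
    (M : ℕ) : Set (GridTensor N M) :=
  {A | ∃ (u₁ u₂ : Fin N → Fin r → Fin M → ℝ)
      (W₁ W₂ : Finset (Fin N) → Finset (Fin N) → Fin r → Fin r → ℝ)
      (o₁ o₂ : Fin r → ℝ)
      (ψ₁ ψ₂ φ₁ φ₂ : Finset (Fin N) → Fin r → GridTensor N M),
    (∀ i γ d, ψ₁ {i} γ d = u₁ i γ (d i)) ∧
    (∀ i γ d, ψ₂ {i} γ d = u₂ i γ (d i)) ∧
    (∀ ν p q, T₁.IsChildren ν p q → ∀ γ,
      ψ₁ ν γ = outerStep (s := fun _ => r) φ₁ p q (W₁ ν p) (W₁ ν q) γ) ∧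
    (∀ ν p q, T₂.IsChildren ν p q → ∀ γ,
      ψ₂ ν γ = outerStep (s := fun _ => r) φ₂ p q (W₂ ν p) (W₂ ν q) γ) ∧
    (∀ ν γ, φ₁ ν γ =
      if ν ∈ T₁.interior ∩ T₂.interior ∧ γ ∈ E ν then ψ₂ ν γ else ψ₁ ν γ) ∧
    (∀ ν γ, φ₂ ν γ =
      if ν ∈ T₁.interior ∩ T₂.interior ∧ γ ∈ E ν then ψ₁ ν γ else ψ₂ ν γ) ∧
    ∀ d, A d = ∑ γ, o₁ γ * φ₁ Finset.univ γ d + ∑ γ, o₂ γ * φ₂ Finset.univ γ d}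

/-- The number of intermediate tensors in the mixed decomposition. -/
def mixedSize {N : ℕ} (T₁ T₂ : ModeTree N) (r : ℕ) : ℕ :=
  treeSize T₁ (fun _ => r) + treeSize T₂ (fun _ => r)

/-! ### Dilated convolutional networks -/

/-- Number of channels in layer `l`: the input has `d` channels, hidden layer `l + 1` has `w l`. -/
@[reducible] def layerWidth (d : ℕ) (w : ℕ → ℕ) : ℕ → ℕ
  | 0 => d
  | l + 1 => w l

/-- A dilated convolution with two taps, at times `t - δ` and `t`, followed by multiplication of the
two taps (linear activation and product pooling). The weights do not depend on the time `t`. -/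
def dilatedConv {k m : ℕ} (δ : ℕ) (a b : Fin k → Fin m → ℝ) (h : ℤ → Fin m → ℝ) :
    ℤ → Fin k → ℝ :=
  fun t γ => (∑ α, a γ α * h (t - δ) α) * ∑ α, b γ α * h t α

/-- Layer `l` of the dilated convolutional network on the input sequence `x`; hidden layer `l + 1`
has dilation `δ l`. -/
def hiddenLayer {d : ℕ} (δ w : ℕ → ℕ)
    (a b : ∀ l, Fin (layerWidth d w (l + 1)) → Fin (layerWidth d w l) → ℝ)
    (x : ℤ → Fin d → ℝ) : ∀ l, ℤ → Fin (layerWidth d w l) → ℝ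
  | 0 => x
  | l + 1 => dilatedConv (δ l) (a l) (b l) (hiddenLayer δ w a b x l)

/-- The functions from input sequences to output sequences realized by dilated convolutional
networks with `L` hidden layers, dilations `δ 0, …, δ (L - 1)`, `d` input channels and hidden layers
of widths `w 0, …, w (L - 1)`, followed by a linear output. -/
def networkFunctions (L : ℕ) (δ : ℕ → ℕ) (d : ℕ) (w : ℕ → ℕ) :
    Set ((ℤ → Fin d → ℝ) → ℤ → ℝ) :=
  {F | ∃ (a b : ∀ l, Fin (layerWidth d w (l + 1)) → Fin (layerWidth d w l) → ℝ)
      (o : Fin (layerWidth d w L) → ℝ),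
    ∀ x t, F x t = ∑ γ, o γ * hiddenLayer δ w a b x L t γ}

/-- Layer `l` of the two interconnected networks with dilations `δ₁`, `δ₂` and `r` channels in every
hidden layer. In hidden layer `l + 1` the channels in `E l` are exchanged between the networks. -/
def mixedLayer {d r : ℕ} (δ₁ δ₂ : ℕ → ℕ) (E : ℕ → Finset (Fin r))
    (a₁ b₁ a₂ b₂ : ∀ l, Fin r → Fin (layerWidth d (fun _ => r) l) → ℝ)
    (x : ℤ → Fin d → ℝ) :
    ∀ l, (ℤ → Fin (layerWidth d (fun _ => r) l) → ℝ) ×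
      (ℤ → Fin (layerWidth d (fun _ => r) l) → ℝ)
  | 0 => (x, x)
  | l + 1 =>
    let h := mixedLayer δ₁ δ₂ E a₁ b₁ a₂ b₂ x l
    let g₁ : ℤ → Fin r → ℝ := dilatedConv (δ₁ l) (a₁ l) (b₁ l) h.1
    let g₂ : ℤ → Fin r → ℝ := dilatedConv (δ₂ l) (a₂ l) (b₂ l) h.2
    (fun t (γ : Fin r) => if γ ∈ E l then g₂ t γ else g₁ t γ,
      fun t (γ : Fin r) => if γ ∈ E l then g₁ t γ else g₂ t γ)

/-- The functions realized by the mixed network. -/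
def mixedNetworkFunctions (L : ℕ) (δ₁ δ₂ : ℕ → ℕ) (d r : ℕ) (E : ℕ → Finset (Fin r)) :
    Set ((ℤ → Fin d → ℝ) → ℤ → ℝ) :=
  {F | ∃ (a₁ b₁ a₂ b₂ : ∀ l, Fin r → Fin (layerWidth d (fun _ => r) l) → ℝ)
      (o₁ o₂ : Fin (layerWidth d (fun _ => r) L) → ℝ),
    ∀ x t, F x t =
      ∑ γ, o₁ γ * (mixedLayer δ₁ δ₂ E a₁ b₁ a₂ b₂ x L).1 t γ +
      ∑ γ, o₂ γ * (mixedLayer δ₁ δ₂ E a₁ b₁ a₂ b₂ x L).2 t γ}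

/-- The dilations of the `L` hidden layers are `1, 2, 4, …, 2 ^ (L - 1)` in some order, so that the
output at time `t` reads each of the `2 ^ L` latest inputs exactly once. -/
def IsDilationSchedule (L : ℕ) (δ : ℕ → ℕ) : Prop :=
  ∃ σ : Equiv.Perm (Fin L), ∀ l : Fin L, δ l = 2 ^ (σ l : ℕ)

/-!
Both lower bounds are matrix rank estimates. In a hierarchical decomposition, the matricization of
the generated tensor with respect to a node `ν` of the tree (rows indexed by the modes in `ν`,
columns by the other modes) has rank at most the number of tensors at `ν`
(`exists_factorization_of_mem_treeTensors`). It therefore suffices to find a tensor in the mixed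
decomposition having a matricization of rank quadratic in `r` for a node of each of the two trees.

If the trees cut out different bipartitions, then some node `ν` of `T₁` crosses some node `μ` of `T₂`
(`ModeTree.exists_crossing_nodes`): there are modes `a ∈ ν ∩ μ`, `b ∈ ν \ μ`, `c ∈ μ \ ν` and
`e ∉ ν ∪ μ`. Let `k = ⌈r / 2⌉`. As `ν` separates `{a, b}` from `{c, e}`, the paths in `T₁` from `a`
to `b` and from `c` to `e` are disjoint, so `T₁` generates with `k` tensors per node the tensor that
is `1` where the indices agree, and are smaller than `k`, along `a`, `b` and along `c`, `e`, and is
`0` elsewhere (`quartetTensor_mem_treeTensors`). Likewise `T₂` generates the tensor that compares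
`a` with `c` and `b` with `e`. The mixed decomposition generates the sum of the two: there are at
least `k` channels at each node that are not exchanged, and with zeros in all others the exchange has
no effect (`add_mem_mixedTensors`). Across `ν`, the first summand restricts to a matrix `w wᵀ` and
the second one to the identity matrix of size `k ^ 2`; across `μ` the roles are interchanged. Since
`1 + w wᵀ` is positive definite, it has full rank `k ^ 2` (`mul_self_le_of_factorization`).

For dilated networks, let `m` be the first layer in which the two orders of the dilations differ, and
put `P = δ₁ m`, `Q = δ₂ m`. The inputs at the times `0, -P, -Q, -(P + Q)` play the roles of
`a, b, c, e`. The weights do not depend on time, so the networks cannot single out these times;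
instead, the network for `δ₁` compares the inputs at `t` and `t - P` for all relevant times `t` and
multiplies the results. If the input is constant except at the four times, only two of these
comparisons matter, and the same two matrices as before appear
(`IsDilationSchedule.sum_hiddenLayer_testSeq`).
-/

/-! ### A matrix of full rank -/

/-- The sum of the identity matrix of size `k ^ 2` and the rank-one matrix `w wᵀ`, where `w` is the
indicator of the diagonal, is positive definite, so it does not factor through fewer than `k ^ 2`
dimensions. -/
theorem mul_self_le_of_factorization {k s : ℕ} (H : Fin k × Fin k → Fin s → ℝ)
    (G : Fin s → Fin k × Fin k → ℝ)
    (h : ∀ u v, ∑ α, H u α * G α v =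
      (if u.1 = u.2 then 1 else 0) * (if v.1 = v.2 then 1 else 0) +
        (if u.1 = v.1 then 1 else 0) * (if u.2 = v.2 then 1 else 0)) :
    k * k ≤ s := by
  classical
  set w : Fin k × Fin k → ℝ := fun u => if u.1 = u.2 then 1 else 0
  have hmul : Matrix.of H * Matrix.of G = 1 + Matrix.vecMulVec w w := by
    ext u v
    rw [Matrix.mul_apply]
    simp only [Matrix.of_apply, h, Matrix.add_apply, Matrix.one_apply, Matrix.vecMulVec_apply, w,
      Prod.ext_iff]
    rw [add_comm]
    congr 1
    split_ifs <;> simp_all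
  have hpos : (1 + Matrix.vecMulVec w w).PosDef := by
    have := Matrix.posSemidef_vecMulVec_self_star w
    rw [star_trivial] at this
    exact Matrix.PosDef.one.add_posSemidef this
  have hrank := Matrix.rank_of_isUnit _ hpos.isUnit
  rw [← hmul] at hrank
  have h₁ := (Matrix.rank_mul_le_left (Matrix.of H) (Matrix.of G)).trans
    (Matrix.rank_le_card_width (Matrix.of H))
  simpa [hrank] using h₁

/-! ### Crossing nodes -/

namespace ModeTree

variable {N : ℕ}

theorem IsChildren.left_ssubset {T : ModeTree N} {ν p q : Finset (Fin N)}
    (h : T.IsChildren ν p q) : p ⊂ ν := by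
  obtain ⟨-, -, hq, hd, rfl⟩ := h
  obtain ⟨x, hx⟩ := T.nonempty_of_mem q hq
  refine (Finset.ssubset_iff_of_subset Finset.subset_union_left).2
    ⟨x, Finset.mem_union_right _ hx, fun hxp => Finset.disjoint_left.1 hd hxp hx⟩

theorem IsChildren.symm {T : ModeTree N} {ν p q : Finset (Fin N)}
    (h : T.IsChildren ν p q) : T.IsChildren ν q p :=
  ⟨h.1, h.2.2.1, h.2.1, h.2.2.2.1.symm, by rw [Finset.union_comm]; exact h.2.2.2.2⟩

theorem IsChildren.mem_iff {T : ModeTree N} {ν p q : Finset (Fin N)}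
    (h : T.IsChildren ν p q) {x : Fin N} : x ∈ ν ↔ x ∈ p ∨ x ∈ q := by
  rw [← h.2.2.2.2, Finset.mem_union]

theorem IsChildren.not_mem_right {T : ModeTree N} {ν p q : Finset (Fin N)}
    (h : T.IsChildren ν p q) {x : Fin N} (hx : x ∈ p) : x ∉ q :=
  Finset.disjoint_left.1 h.2.2.2.1 hx

theorem exists_isChildren_or_eq_singleton (T : ModeTree N) {ν : Finset (Fin N)}
    (hν : ν ∈ T.nodes) : (∃ p q, T.IsChildren ν p q) ∨ ∃ i, ν = {i} := by
  rcases Nat.lt_or_ge 1 ν.card with h | h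
  · obtain ⟨p, hp, q, hq, hd, hu⟩ := T.exists_children ν hν h
    exact Or.inl ⟨p, q, hν, hp, hq, hd, hu⟩
  · have := (T.nonempty_of_mem ν hν).card_pos
    exact Or.inr (Finset.card_eq_one.1 (by omega))

/-- A node strictly below `ν` lies below one of the children of `ν`. -/
theorem IsChildren.subset_or_subset {T : ModeTree N} {ν p q ρ : Finset (Fin N)}
    (h : T.IsChildren ν p q) (hρ : ρ ∈ T.nodes) (hρν : ρ ⊂ ν) : ρ ⊆ p ∨ ρ ⊆ q := by
  obtain ⟨x, hxν, hxρ⟩ := Finset.exists_of_ssubset hρν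
  wlog hxp : x ∈ p generalizing p q
  · exact (this h.symm ((h.mem_iff.1 hxν).resolve_left hxp)).symm
  have key : ∀ y ∈ ρ, y ∈ p ∨ y ∈ q := fun y hy => h.mem_iff.1 (hρν.1 hy)
  rcases T.laminar ρ hρ p h.2.1 with h₁ | h₁ | h₁
  · exact Or.inl h₁
  · exact absurd (h₁ hxp) hxρ
  · exact Or.inr fun y hy => (key y hy).resolve_left (Finset.disjoint_left.1 h₁ hy)

/-- A set of modes that is not a side of a bipartition of the tree crosses some node: all four
regions cut out by the two sets are nonempty. The node is a minimal one that meets both the set and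
its complement; its children are then contained in the set and in the complement, respectively. -/
theorem exists_crossing (T : ModeTree N) {S : Finset (Fin N)} (hS : S ∉ T.bipartitions) :
    ∃ μ ∈ T.nodes, ∃ a b c e, (a ∈ S ∧ a ∈ μ) ∧ (b ∈ S ∧ b ∉ μ) ∧ (c ∉ S ∧ c ∈ μ) ∧
      (e ∉ S ∧ e ∉ μ) := by
  classical
  have hST : S ∉ T.nodes := fun h => hS (Finset.mem_union_left _ h)
  have hSc : Sᶜ ∉ T.nodes := fun h =>
    hS (Finset.mem_union_right _ (Finset.mem_image.2 ⟨_, h, compl_compl S⟩))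
  -- the root meets both `S` and its complement, since otherwise one of these would be the root
  have hex : ((T.nodes.filter fun μ => (∃ a ∈ S, a ∈ μ) ∧ ∃ c, c ∉ S ∧ c ∈ μ)).Nonempty := by
    refine ⟨Finset.univ, Finset.mem_filter.2 ⟨T.root_mem, ?_, ?_⟩⟩
    · by_contra! h
      refine hSc ?_
      have : S = ∅ := Finset.eq_empty_of_forall_notMem fun x hx => h x hx (Finset.mem_univ x)
      simpa [this] using T.root_mem
    · by_contra! h
      refine hST ?_
      have : S = Finset.univ := Finset.eq_univ_of_forall fun x => by
        by_contra hx
        exact h x hx (Finset.mem_univ x)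
      simpa [this] using T.root_mem
  obtain ⟨μ, hμ, hmin⟩ := Finset.exists_min_image _ Finset.card hex
  obtain ⟨hμT, ⟨a, haS, haμ⟩, c, hcS, hcμ⟩ := Finset.mem_filter.1 hμ
  refine ⟨μ, hμT, ?_⟩
  by_contra hno
  rcases T.exists_isChildren_or_eq_singleton hμT with ⟨p, q, hpq⟩ | ⟨i, rfl⟩
  swap
  · rw [Finset.mem_singleton] at haμ hcμ
    exact hcS (hcμ ▸ haμ ▸ haS)
  -- by minimality, each child of `μ` lies on one side of `S`
  have pure : ∀ {p q}, T.IsChildren μ p q → ∀ x ∈ S, x ∈ p → ∀ y ∈ p, y ∈ S := by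
    intro p q h x hxS hxp y hyp
    by_contra hyS
    have := hmin p (Finset.mem_filter.2 ⟨h.2.1, ⟨x, hxS, hxp⟩, y, hyS, hyp⟩)
    exact absurd (Finset.card_lt_card h.left_ssubset) (by omega)
  wlog hap : a ∈ p generalizing p q
  · exact this q p hpq.symm ((hpq.mem_iff.1 haμ).resolve_left hap)
  have hpS := pure hpq a haS hap
  have hcq : c ∈ q := (hpq.mem_iff.1 hcμ).resolve_left fun h => hcS (hpS c h)
  have hqS : ∀ y ∈ q, y ∉ S := fun y hy hyS => hcS (pure hpq.symm y hyS hy c hcq)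
  -- if `μ` does not cross `S`, then `Sᶜ ⊆ μ` or `S ⊆ μ`, so `Sᶜ = q` or `S = p`
  by_cases hsub : ∃ b ∈ S, b ∉ μ
  · obtain ⟨b, hbS, hbμ⟩ := hsub
    refine hSc (?_ : Sᶜ ∈ T.nodes)
    have : Sᶜ = q := by
      ext y
      rw [Finset.mem_compl]
      refine ⟨fun hy => ?_, hqS y⟩
      have hyμ : y ∈ μ := by
        by_contra hyμ
        exact hno ⟨a, b, c, y, ⟨haS, haμ⟩, ⟨hbS, hbμ⟩, ⟨hcS, hcμ⟩, hy, hyμ⟩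
      exact (hpq.mem_iff.1 hyμ).resolve_left fun h => hy (hpS y h)
    rw [this]
    exact hpq.2.2.1
  · push Not at hsub
    have : S = p := by
      ext y
      exact ⟨fun hy => (hpq.mem_iff.1 (hsub y hy)).resolve_right fun h => hqS y h hy, hpS y⟩
    exact hST (this ▸ hpq.2.1)

theorem exists_crossing_nodes {T₁ T₂ : ModeTree N} (h : T₁.bipartitions ≠ T₂.bipartitions) :
    ∃ ν ∈ T₁.nodes, ∃ μ ∈ T₂.nodes, ∃ a b c e, (a ∈ ν ∧ a ∈ μ) ∧ (b ∈ ν ∧ b ∉ μ) ∧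
      (c ∉ ν ∧ c ∈ μ) ∧ (e ∉ ν ∧ e ∉ μ) := by
  classical
  have key : ∀ {T₁ T₂ : ModeTree N}, ¬ T₁.bipartitions ⊆ T₂.bipartitions →
      ∃ ν ∈ T₁.nodes, ν ∉ T₂.bipartitions := by
    intro T₁ T₂ h
    obtain ⟨S, hS₁, hS₂⟩ := Finset.not_subset.1 h
    rcases Finset.mem_union.1 hS₁ with hS | hS
    · exact ⟨S, hS, hS₂⟩
    · obtain ⟨ν, hν, rfl⟩ := Finset.mem_image.1 hS
      refine ⟨ν, hν, fun hν₂ => hS₂ ?_⟩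
      rcases Finset.mem_union.1 hν₂ with h' | h'
      · exact Finset.mem_union_right _ (Finset.mem_image_of_mem _ h')
      · obtain ⟨ρ, hρ, rfl⟩ := Finset.mem_image.1 h'
        exact Finset.mem_union_left _ (by rwa [compl_compl])
  by_cases h₁ : T₁.bipartitions ⊆ T₂.bipartitions
  · obtain ⟨μ, hμ, hμ₁⟩ := key fun h₂ => h (h₁.antisymm h₂)
    obtain ⟨ν, hν, a, b, c, e, ha, hb, hc, he⟩ := T₁.exists_crossing hμ₁
    exact ⟨ν, hν, μ, hμ, a, c, b, e, ha.symm, hc.symm, hb.symm, he.symm⟩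
  · obtain ⟨ν, hν, hν₂⟩ := key h₁
    obtain ⟨μ, hμ, h⟩ := T₂.exists_crossing hν₂
    exact ⟨ν, hν, μ, hμ, h⟩

end ModeTree

/-! ### Matricization ranks of hierarchical decompositions -/

section Rank

variable {N M : ℕ} {T : ModeTree N} {s : Finset (Fin N) → ℕ}
  {u : ∀ i : Fin N, Fin (s {i}) → Fin M → ℝ}
  {W : ∀ ν p : Finset (Fin N), Fin (s ν) → Fin (s p) → ℝ}
  {φ : ∀ ν, Fin (s ν) → GridTensor N M}

theorem node_tensor_congr (hu : ∀ i γ d, φ {i} γ d = u i γ (d i))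
    (hW : ∀ ν p q, T.IsChildren ν p q → ∀ γ, φ ν γ = outerStep φ p q (W ν p) (W ν q) γ)
    {ν : Finset (Fin N)} (hν : ν ∈ T.nodes) {d d' : Fin N → Fin M} (hd : ∀ i ∈ ν, d i = d' i)
    (γ : Fin (s ν)) : φ ν γ d = φ ν γ d' := by
  induction ν using Finset.strongInduction with
  | H ν ih =>
    rcases T.exists_isChildren_or_eq_singleton hν with ⟨p, q, h⟩ | ⟨i, rfl⟩
    · rw [hW ν p q h]
      unfold outerStep
      have hp := ih p h.left_ssubset h.2.1 fun i hi => hd i (h.left_ssubset.1 hi)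
      have hq := ih q h.symm.left_ssubset h.2.2.1 fun i hi => hd i (h.symm.left_ssubset.1 hi)
      simp only [hp, hq]
    · rw [hu, hu, hd i (Finset.mem_singleton_self i)]

/-- Along a family of grid points `d x y` whose coordinates in the node `ν` depend on `x` only and
whose other coordinates depend on `y` only, every tensor at a node above `ν` is a combination of the
tensors at `ν`, with coefficients that are functions of `y`. -/
theorem exists_node_factorization (hu : ∀ i γ d, φ {i} γ d = u i γ (d i))
    (hW : ∀ ν p q, T.IsChildren ν p q → ∀ γ, φ ν γ = outerStep φ p q (W ν p) (W ν q) γ)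
    {ν : Finset (Fin N)} (hν : ν ∈ T.nodes) {X Y : Type*} (x₀ : X) (d : X → Y → Fin N → Fin M)
    (hout : ∀ i ∉ ν, ∀ x x' y, d x y i = d x' y i)
    {κ : Finset (Fin N)} (hκ : κ ∈ T.nodes) (hνκ : ν ⊆ κ) :
    ∃ G : Fin (s κ) → Fin (s ν) → Y → ℝ, ∀ x y γ,
      φ κ γ (d x y) = ∑ α, φ ν α (d x y) * G γ α y := by
  induction κ using Finset.strongInduction with
  | H κ ih =>
    rcases eq_or_ne ν κ with rfl | hne
    · exact ⟨fun γ α _ => if α = γ then 1 else 0, by simp⟩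
    have hss : ν ⊂ κ := lt_of_le_of_ne hνκ hne
    rcases T.exists_isChildren_or_eq_singleton hκ with ⟨p, q, h⟩ | ⟨i, rfl⟩
    swap
    · obtain ⟨j, hj⟩ := T.nonempty_of_mem ν hν
      exact absurd (Finset.eq_singleton_iff_unique_mem.2
        ⟨Finset.mem_singleton.1 (hνκ hj) ▸ hj, fun y hy => Finset.mem_singleton.1 (hνκ hy)⟩) hne
    wlog hp : ν ⊆ p generalizing p q
    · exact this q p h.symm ((h.subset_or_subset hν hss).resolve_left hp)
    obtain ⟨G, hG⟩ := ih p h.left_ssubset h.2.1 hp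
    -- the sibling `q` is disjoint from `ν`, so its tensors are functions of `y`
    have hq : ∀ x y α, φ q α (d x y) = φ q α (d x₀ y) := fun x y α =>
      node_tensor_congr hu hW h.2.2.1
        (fun i hi => hout i (fun hiν => h.not_mem_right (hp hiν) hi) x x₀ y) α
    refine ⟨fun γ α y => (∑ β, W κ p γ β * G β α y) * ∑ β, W κ q γ β * φ q β (d x₀ y), ?_⟩
    intro x y γ
    rw [hW κ p q h]
    unfold outerStep
    simp only [hG, hq x y, ← mul_assoc]
    rw [← Finset.sum_mul]
    congr 1
    simp only [Finset.mul_sum]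
    rw [Finset.sum_comm]
    exact Finset.sum_congr rfl fun α _ => Finset.sum_congr rfl fun β _ => by ring

/-- The matricization of a generated tensor with respect to a node of the tree has rank at most the
number of tensors at this node. -/
theorem exists_factorization_of_mem_treeTensors {A : GridTensor N M} (hA : A ∈ treeTensors T s M)
    {ν : Finset (Fin N)} (hν : ν ∈ T.nodes) {X Y : Type*} (x₀ : X) (y₀ : Y)
    (d : X → Y → Fin N → Fin M)
    (hin : ∀ i ∈ ν, ∀ x y y', d x y i = d x y' i) (hout : ∀ i ∉ ν, ∀ x x' y, d x y i = d x' y i) :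
    ∃ (H : X → Fin (s ν) → ℝ) (G : Fin (s ν) → Y → ℝ),
      ∀ x y, A (d x y) = ∑ α, H x α * G α y := by
  obtain ⟨u, W, o, φ, hu, hW, ho⟩ := hA
  obtain ⟨G, hG⟩ := exists_node_factorization hu hW hν x₀ d hout T.root_mem (Finset.subset_univ ν)
  refine ⟨fun x α => φ ν α (d x y₀), fun α y => ∑ γ, o γ * G γ α y, fun x y => ?_⟩
  have hφ : ∀ α, φ ν α (d x y₀) = φ ν α (d x y) := fun α =>
    node_tensor_congr hu hW hν (fun i hi => hin i hi x y₀ y) α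
  simp only [ho, hG, hφ, Finset.mul_sum]
  rw [Finset.sum_comm]
  exact Finset.sum_congr rfl fun α _ => Finset.sum_congr rfl fun γ _ => by ring

end Rank

/-! ### Quartet tensors -/

section Quartet

variable {N M : ℕ}

/-- The indicator of the multi-indices in which the modes `i` and `j` carry the same index, smaller
than `k`. -/
def pairTensor (k : ℕ) (i j : Fin N) : GridTensor N M :=
  fun d => if (d i : ℕ) = d j ∧ (d i : ℕ) < k then 1 else 0

/-- The product of the pair tensors for `{a, b}` and `{c, e}`. If a bipartition of the modes separates
`a`, `c` from `b`, `e`, the matricization along it has rank `k ^ 2`, provided that `k ≤ M`. -/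
def quartetTensor (k : ℕ) (a b c e : Fin N) : GridTensor N M :=
  fun d => pairTensor k a b d * pairTensor k c e d

/-- `p` is the least node of `T` that contains both `i` and `j`. -/
def ModeTree.IsMeet (T : ModeTree N) (i j : Fin N) (p : Finset (Fin N)) : Prop :=
  i ∈ p ∧ j ∈ p ∧ ∀ ρ ∈ T.nodes, ρ ⊂ p → ¬(i ∈ ρ ∧ j ∈ ρ)

/-- The contribution to `pairTensor k i j` of the modes in `p`, where the channel `γ` remembers the
common index as long as `p` contains only one of `i` and `j`. -/
def pairCarry (k : ℕ) (i j : Fin N) (p : Finset (Fin N)) (γ : ℕ) : GridTensor N M :=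
  fun d =>
    if i ∈ p then if j ∈ p then pairTensor k i j d else if (d i : ℕ) = γ then 1 else 0
    else if j ∈ p then if (d j : ℕ) = γ then 1 else 0 else 1

open Classical in
/-- The `γ`-th tensor at the node `p` of a decomposition of `pairTensor k i j`. It agrees with
`pairCarry`, except that at the node where `i` and `j` meet the sum over the common index has not
been carried out yet. -/
noncomputable def pairNode (T : ModeTree N) (k : ℕ) (i j : Fin N) (p : Finset (Fin N)) (γ : ℕ) :
    GridTensor N M :=
  fun d =>
    if T.IsMeet i j p then (if (d i : ℕ) = γ then 1 else 0) * (if (d j : ℕ) = γ then 1 else 0)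
    else pairCarry k i j p γ d

theorem pairNode_eq_mul {T : ModeTree N} {ν p q : Finset (Fin N)} (h : T.IsChildren ν p q) (k : ℕ)
    (i j : Fin N) (γ : ℕ) (d : Fin N → Fin M) :
    pairNode T k i j ν γ d = pairCarry k i j p γ d * pairCarry k i j q γ d := by
  have hmeet : T.IsMeet i j ν ↔ (i ∈ p ∧ j ∈ q) ∨ (i ∈ q ∧ j ∈ p) := by
    constructor
    · rintro ⟨hi, hj, hmin⟩
      have hp := hmin p h.2.1 h.left_ssubset
      have hq := hmin q h.2.2.1 h.symm.left_ssubset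
      rw [h.mem_iff] at hi hj
      tauto
    · intro hij
      refine ⟨h.mem_iff.2 (by tauto), h.mem_iff.2 (by tauto), fun ρ hρ hρν ⟨hi, hj⟩ => ?_⟩
      rcases h.subset_or_subset hρ hρν with hs | hs
      · rcases hij with hij | hij
        · exact h.not_mem_right (hs hj) hij.2
        · exact h.not_mem_right (hs hi) hij.1
      · rcases hij with hij | hij
        · exact h.not_mem_right hij.1 (hs hi)
        · exact h.not_mem_right hij.2 (hs hj)
  have hi := h.not_mem_right (x := i)
  have hj := h.not_mem_right (x := j)
  unfold pairNode pairCarry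
  simp only [hmeet, h.mem_iff]
  by_cases h₁ : i ∈ p <;> by_cases h₂ : i ∈ q <;> by_cases h₃ : j ∈ p <;> by_cases h₄ : j ∈ q <;>
    simp_all [mul_comm]

theorem sum_meet (k : ℕ) (i j : Fin N) (d : Fin N → Fin M) :
    ∑ α : Fin k, ((if (d i : ℕ) = α then 1 else 0) * (if (d j : ℕ) = α then 1 else 0) : ℝ) =
      pairTensor k i j d := by
  unfold pairTensor
  by_cases hk : (d i : ℕ) < k
  · rw [Finset.sum_eq_single ⟨d i, hk⟩]
    · simp [hk, eq_comm]
    · intro α _ hα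
      rw [if_neg, zero_mul]
      exact fun h => hα (Fin.ext h.symm)
    · simp
  · rw [if_neg fun h => hk h.2]
    refine Finset.sum_eq_zero fun α _ => ?_
    rw [if_neg, zero_mul]
    intro h
    have := α.2
    omega

theorem pairCarry_congr {k : ℕ} {i j : Fin N} {p : Finset (Fin N)} (h : i ∈ p ↔ j ∈ p) (γ γ' : ℕ)
    (d : Fin N → Fin M) : pairCarry k i j p γ d = pairCarry k i j p γ' d := by
  unfold pairCarry
  by_cases hi : i ∈ p <;> simp_all

open Classical in
/-- The weights that combine the tensors at the node `p`: the sum over the common index is carried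
out at the two meeting nodes, all other weights are identity matrices. -/
noncomputable def quartetWeight (T : ModeTree N) (a b c e : Fin N) (p : Finset (Fin N)) (γ α : ℕ) : ℝ :=
  if T.IsMeet a b p ∨ T.IsMeet c e p then 1 else if γ = α then 1 else 0

variable {T : ModeTree N} {ν : Finset (Fin N)} {a b c e : Fin N}

/-- If a node `ν` contains `a` and `b`, but neither `c` nor `e`, then the paths in the tree from `a`
to `b` and from `c` to `e` are disjoint, so that no node has to carry two indices at a time. -/
theorem sum_quartetWeight_mul (hν : ν ∈ T.nodes) (ha : a ∈ ν) (hb : b ∈ ν) (hc : c ∉ ν) (he : e ∉ ν)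
    {p : Finset (Fin N)} (hp : p ∈ T.nodes) (k : ℕ) (γ : Fin k) (d : Fin N → Fin M) :
    ∑ α : Fin k, quartetWeight T a b c e p γ α *
        (pairNode T k a b p α d * pairNode T k c e p α d) =
      pairCarry k a b p γ d * pairCarry k c e p γ d := by
  by_cases h₁ : T.IsMeet a b p
  · have hpν : p ⊆ ν := by
      rcases T.laminar p hp ν hν with h | h | h
      · exact h
      · rcases eq_or_ne ν p with rfl | hne
        · exact subset_rfl
        · exact absurd ⟨ha, hb⟩ (h₁.2.2 ν hν (lt_of_le_of_ne h hne))
      · exact absurd ha (Finset.disjoint_left.1 h h₁.1)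
    have hcp : c ∉ p := fun h => hc (hpν h)
    have hep : e ∉ p := fun h => he (hpν h)
    have h₂ : ¬ T.IsMeet c e p := fun h => hcp h.1
    have h₃ : pairCarry k a b p γ d = pairTensor k a b d := by
      simp [pairCarry, h₁.1, h₁.2.1]
    simp only [quartetWeight, pairNode, h₁, h₂, true_or, if_true, if_false, one_mul,
      pairCarry_congr (iff_of_false hcp hep) _ (γ : ℕ) d]
    rw [← Finset.sum_mul, sum_meet, h₃]
  · by_cases h₂ : T.IsMeet c e p
    · have hab : a ∈ p ↔ b ∈ p := by
        rcases T.laminar p hp ν hν with h | h | h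
        · exact absurd (h h₂.1) hc
        · exact iff_of_true (h ha) (h hb)
        · exact iff_of_false (fun h' => Finset.disjoint_left.1 h h' ha)
            (fun h' => Finset.disjoint_left.1 h h' hb)
      have h₃ : pairCarry k c e p γ d = pairTensor k c e d := by
        simp [pairCarry, h₂.1, h₂.2.1]
      simp only [quartetWeight, pairNode, h₁, h₂, or_true, if_true, if_false, one_mul,
        pairCarry_congr hab _ (γ : ℕ) d]
      rw [← Finset.mul_sum, sum_meet, h₃]
    · simp only [quartetWeight, pairNode, h₁, h₂, or_self, if_false, ite_mul, one_mul, zero_mul,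
        ← Fin.ext_iff]
      rw [Finset.sum_ite_eq]
      simp

theorem quartetTensor_mem_treeTensors (hν : ν ∈ T.nodes) (ha : a ∈ ν) (hb : b ∈ ν) (hc : c ∉ ν)
    (he : e ∉ ν) (hab : a ≠ b) (hce : c ≠ e) {k : ℕ} (hk : 0 < k) :
    (quartetTensor k a b c e : GridTensor N M) ∈ treeTensors T (fun _ => k) M := by
  classical
  have hleaf : ∀ {i j x : Fin N}, i ≠ j → ∀ (γ : ℕ) (d : Fin N → Fin M),
      pairNode T k i j {x} γ d = if x = i ∨ x = j then if (d x : ℕ) = γ then 1 else 0 else 1 := by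
    intro i j x hij γ d
    have : ¬ T.IsMeet i j {x} := by
      rintro ⟨hi, hj, -⟩
      rw [Finset.mem_singleton] at hi hj
      exact hij (hi.trans hj.symm)
    simp only [pairNode, this, if_false, pairCarry, Finset.mem_singleton]
    by_cases hi : i = x <;> by_cases hj : j = x <;> simp_all [eq_comm]
  have hC : ∀ d : Fin N → Fin M,
      pairCarry k a b Finset.univ (⟨0, hk⟩ : Fin k) d *
        pairCarry k c e Finset.univ (⟨0, hk⟩ : Fin k) d = quartetTensor k a b c e d := by
    intro d
    simp [pairCarry, quartetTensor]
  refine ⟨fun i γ m => (if i = a ∨ i = b then if (m : ℕ) = γ then 1 else 0 else 1) *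
      (if i = c ∨ i = e then if (m : ℕ) = γ then 1 else 0 else 1),
    fun _ p γ α => quartetWeight T a b c e p γ α,
    fun α => quartetWeight T a b c e Finset.univ (⟨0, hk⟩ : Fin k) α,
    fun p γ d => pairNode T k a b p γ d * pairNode T k c e p γ d, ?_, ?_, ?_⟩
  · intro i γ d
    simp only [hleaf hab, hleaf hce]
  · intro κ p q h γ
    funext d
    unfold outerStep
    rw [sum_quartetWeight_mul hν ha hb hc he h.2.1, sum_quartetWeight_mul hν ha hb hc he h.2.2.1]
    beta_reduce
    rw [pairNode_eq_mul h, pairNode_eq_mul h]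
    ring
  · intro d
    rw [sum_quartetWeight_mul hν ha hb hc he T.root_mem, hC]

/-- Across the node `ν`, which separates `{a, b}` from `{c, e}`, the sum of two quartet tensors has
rank at least `k ^ 2`: the first one contributes a matrix of rank one, the second one an identity
matrix. -/
theorem mul_self_le_treeSize (hν : ν ∈ T.nodes) (ha : a ∈ ν) (hb : b ∈ ν) (hc : c ∉ ν)
    (he : e ∉ ν) (hab : a ≠ b) (hce : c ≠ e) {k : ℕ} (hk : 0 < k) (hkM : k ≤ M)
    {s : Finset (Fin N) → ℕ}
    (hA : (fun d => quartetTensor k a b c e d + quartetTensor k a c b e d) ∈ treeTensors T s M) :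
    k * k ≤ treeSize T s := by
  have hac : a ≠ c := fun h => hc (h ▸ ha)
  have hae : a ≠ e := fun h => he (h ▸ ha)
  have hbc : b ≠ c := fun h => hc (h ▸ hb)
  have hbe : b ≠ e := fun h => he (h ▸ hb)
  let x₀ : Fin k × Fin k := (⟨0, hk⟩, ⟨0, hk⟩)
  let d : Fin k × Fin k → Fin k × Fin k → Fin N → Fin M := fun u v i =>
    Fin.castLE hkM (if i = a then u.1 else if i = b then u.2 else if i = c then v.1 else
      if i = e then v.2 else ⟨0, hk⟩)
  obtain ⟨H, G, h⟩ := exists_factorization_of_mem_treeTensors hA hν x₀ x₀ d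
    (by
      intro i hi u v v'
      have h₁ : i ≠ c := fun h => hc (h ▸ hi)
      have h₂ : i ≠ e := fun h => he (h ▸ hi)
      simp [d, h₁, h₂])
    (by
      intro i hi u u' v
      have h₁ : i ≠ a := fun h => hi (h ▸ ha)
      have h₂ : i ≠ b := fun h => hi (h ▸ hb)
      simp [d, h₁, h₂])
  have hcard : 1 < ν.card := Finset.one_lt_card.2 ⟨a, ha, b, hb, hab⟩
  refine (mul_self_le_of_factorization H G fun u v => ?_).trans
    (Finset.single_le_sum (f := s) (fun _ _ => Nat.zero_le _)
      (Finset.mem_filter.2 ⟨hν, hcard⟩))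
  rw [← h]
  simp [quartetTensor, pairTensor, d, hab.symm, hac.symm, hae.symm, hbc.symm, hbe.symm, hce.symm,
    ← Fin.ext_iff]

end Quartet

/-! ### Mixed decompositions without exchange -/

section Mixed

variable {N M k r : ℕ} {E : Finset (Fin N) → Finset (Fin r)}

theorem exists_embedding_avoiding {E : Finset (Fin r)} (hE : 2 * E.card ≤ r) (hk : 2 * k ≤ r + 1) :
    ∃ f : Fin k ↪ Fin r, ∀ i, f i ∉ E := by
  classical
  have : Fintype.card (Fin k) ≤ Fintype.card {γ // γ ∉ E} := by
    rw [Fintype.card_subtype_compl, Fintype.card_fin, Fintype.card_fin, Fintype.card_coe]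
    omega
  obtain ⟨f⟩ := Function.Embedding.nonempty_of_card_le this
  exact ⟨f.trans (Function.Embedding.subtype _), fun i => (f i).2⟩

theorem sum_extend_mul_extend (f : Fin k ↪ Fin r) (g h : Fin k → ℝ) :
    ∑ γ, Function.extend f g 0 γ * Function.extend f h 0 γ = ∑ i, g i * h i := by
  classical
  rw [← Finset.sum_subset (Finset.subset_univ (Finset.univ.map f))]
  · simp [f.injective.extend_apply]
  · intro γ _ hγ
    rw [Function.extend_apply', Pi.zero_apply, zero_mul]
    simpa using hγ

/-- A hierarchical decomposition with `k` tensors at each node can be placed into a wider one so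
that all channels in prescribed sets `E ν` vanish. -/
theorem exists_realization_vanishing_on {T : ModeTree N} (hE : ∀ ν, 2 * (E ν).card ≤ r)
    (hk : 2 * k ≤ r + 1) {A : GridTensor N M} (hA : A ∈ treeTensors T (fun _ => k) M) :
    ∃ (u : Fin N → Fin r → Fin M → ℝ) (W : Finset (Fin N) → Finset (Fin N) → Fin r → Fin r → ℝ)
      (o : Fin r → ℝ) (φ : Finset (Fin N) → Fin r → GridTensor N M),
      (∀ i γ d, φ {i} γ d = u i γ (d i)) ∧
      (∀ ν p q, T.IsChildren ν p q → ∀ γ,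
        φ ν γ = outerStep (s := fun _ => r) φ p q (W ν p) (W ν q) γ) ∧
      (∀ d, A d = ∑ γ, o γ * φ Finset.univ γ d) ∧ ∀ ν, ∀ γ ∈ E ν, φ ν γ = 0 := by
  classical
  obtain ⟨u, W, o, φ, hu, hW, ho⟩ := hA
  choose f hf using fun ν => exists_embedding_avoiding (hE ν) hk
  have hsum : ∀ ν (g : Fin k → ℝ) d, ∑ γ, Function.extend (f ν) g 0 γ *
      Function.extend (f ν) (fun i => φ ν i d) 0 γ = ∑ i, g i * φ ν i d := fun ν g d =>
    sum_extend_mul_extend (f ν) g _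
  refine ⟨fun i γ m => Function.extend (f {i}) (fun γ => u i γ m) 0 γ,
    fun ν p γ α => Function.extend (f ν) (fun γ => Function.extend (f p) (W ν p γ) 0) 0 γ α,
    Function.extend (f Finset.univ) o 0,
    fun ν γ d => Function.extend (f ν) (fun γ => φ ν γ d) 0 γ, ?_, ?_, ?_, ?_⟩
  · intro i γ d
    simp only [hu]
  · intro ν p q h γ
    funext d
    unfold outerStep
    by_cases hγ : ∃ i, f ν i = γ
    · obtain ⟨i, rfl⟩ := hγ
      simp only [(f ν).injective.extend_apply, hsum]
      exact congrFun (hW ν p q h i) d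
    · simp [Function.extend_apply' _ _ _ hγ]
  · intro d
    rw [hsum, ho]
  · intro ν γ hγ
    funext d
    beta_reduce
    rw [Function.extend_apply']
    · rfl
    · rintro ⟨i, rfl⟩
      exact hf ν i hγ

/-- Sums of tensors generated by the two trees are generated by the mixed decomposition: when the
exchanged tensors are all zero, the exchange has no effect. -/
theorem add_mem_mixedTensors {T₁ T₂ : ModeTree N} (hE : ∀ ν, 2 * (E ν).card ≤ r)
    (hk : 2 * k ≤ r + 1) {A₁ A₂ : GridTensor N M} (h₁ : A₁ ∈ treeTensors T₁ (fun _ => k) M)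
    (h₂ : A₂ ∈ treeTensors T₂ (fun _ => k) M) :
    (fun d => A₁ d + A₂ d) ∈ mixedTensors T₁ T₂ r E M := by
  obtain ⟨u₁, W₁, o₁, φ₁, hu₁, hW₁, ho₁, hE₁⟩ := exists_realization_vanishing_on hE hk h₁
  obtain ⟨u₂, W₂, o₂, φ₂, hu₂, hW₂, ho₂, hE₂⟩ := exists_realization_vanishing_on hE hk h₂
  refine ⟨u₁, u₂, W₁, W₂, o₁, o₂, φ₁, φ₂, φ₁, φ₂, hu₁, hu₂, hW₁, hW₂, fun ν γ => ?_, fun ν γ => ?_,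
    fun d => congrArg₂ (· + ·) (ho₁ d) (ho₂ d)⟩
  all_goals
    split_ifs with h
    · rw [hE₁ ν γ h.2, hE₂ ν γ h.2]
    · rfl

theorem mixedSize_le (T₁ T₂ : ModeTree N) (r : ℕ) : mixedSize T₁ T₂ r ≤ 2 ^ (N + 1) * r := by
  have h : ∀ T : ModeTree N, treeSize T (fun _ => r) ≤ 2 ^ N * r := fun T => by
    rw [treeSize, Finset.sum_const, smul_eq_mul]
    refine Nat.mul_le_mul_right r ((Finset.card_le_univ _).trans ?_)
    simp
  have h₁ := h T₁
  have h₂ := h T₂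
  rw [mixedSize, pow_succ]
  linarith

theorem exists_mixedTensor_treeSize_lower_bound (N : ℕ) : ∃ c : ℝ, 0 < c ∧
    ∀ T₁ T₂ : ModeTree N, T₁.bipartitions ≠ T₂.bipartitions →
    ∀ (r M : ℕ), r ≤ M →
    ∀ E : Finset (Fin N) → Finset (Fin r), (∀ ν, 2 * (E ν).card ≤ r) →
    ∃ A ∈ mixedTensors T₁ T₂ r E M,
      ∀ T ∈ ({T₁, T₂} : Set (ModeTree N)), ∀ s : Finset (Fin N) → ℕ,
        A ∈ treeTensors T s M →
        c * (mixedSize T₁ T₂ r : ℝ) ^ 2 ≤ (treeSize T s : ℝ) := by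
  -- there are at most `2 ^ N` nodes, so `mixedSize T₁ T₂ r ≤ 2 ^ (N + 1) * r`, and `r ≤ 2 * k`
  -- where `k` is the number of channels in use
  refine ⟨1 / (2 * 2 ^ (N + 1)) ^ 2, by positivity, fun T₁ T₂ hT r M hrM E hE => ?_⟩
  rcases Nat.eq_zero_or_pos r with rfl | hr
  · have hz : ∀ T : ModeTree N, (fun _ => 0 : GridTensor N M) ∈ treeTensors T (fun _ => 0) M :=
      fun T => ⟨fun _ γ => γ.elim0, fun _ _ γ => γ.elim0, fun γ => γ.elim0, fun _ γ => γ.elim0,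
        fun _ γ => γ.elim0, fun _ _ _ _ γ => γ.elim0, fun _ => rfl⟩
    refine ⟨_, add_mem_mixedTensors hE (k := 0) (by omega) (hz T₁) (hz T₂), fun T _ s _ => ?_⟩
    have := mixedSize_le T₁ T₂ 0
    rw [mul_zero, Nat.le_zero] at this
    simp [this]
  obtain ⟨ν, hν, μ, hμ, a, b, c, e, ⟨haν, haμ⟩, ⟨hbν, hbμ⟩, ⟨hcν, hcμ⟩, ⟨heν, heμ⟩⟩ :=
    ModeTree.exists_crossing_nodes hT
  have hab : a ≠ b := fun h => hbμ (h ▸ haμ)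
  have hce : c ≠ e := fun h => heμ (h ▸ hcμ)
  have hac : a ≠ c := fun h => hcν (h ▸ haν)
  have hbe : b ≠ e := fun h => heν (h ▸ hbν)
  obtain ⟨k, hk₁, hk₂⟩ : ∃ k, 2 * k ≤ r + 1 ∧ r ≤ 2 * k := ⟨(r + 1) / 2, by omega, by omega⟩
  have hk : 0 < k := by omega
  have hkM : k ≤ M := by omega
  refine ⟨_, add_mem_mixedTensors hE hk₁
    (quartetTensor_mem_treeTensors hν haν hbν hcν heν hab hce hk)
    (quartetTensor_mem_treeTensors hμ haμ hcμ hbμ heμ hac hbe hk), fun T hT s hA => ?_⟩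
  have hsize : k * k ≤ treeSize T s := by
    rcases hT with rfl | rfl
    · exact mul_self_le_treeSize hν haν hbν hcν heν hab hce hk hkM hA
    · refine mul_self_le_treeSize hμ haμ hcμ hbμ heμ hac hbe hk hkM ?_
      simpa only [add_comm] using hA
  have h₁ : (mixedSize T₁ T₂ r : ℝ) ≤ 2 ^ (N + 1) * (2 * k) := by
    exact_mod_cast (mixedSize_le T₁ T₂ r).trans (Nat.mul_le_mul_left _ hk₂)
  have h₂ : ((k * k : ℕ) : ℝ) ≤ treeSize T s := by exact_mod_cast hsize
  refine le_trans ?_ h₂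
  rw [one_div, inv_mul_le_iff₀ (by positivity)]
  calc (mixedSize T₁ T₂ r : ℝ) ^ 2 ≤ (2 ^ (N + 1) * (2 * k)) ^ 2 := by gcongr
    _ = (2 * 2 ^ (N + 1)) ^ 2 * ((k * k : ℕ) : ℝ) := by push_cast; ring

end Mixed

/-! ### Dilation schedules -/

section Schedule

variable {L : ℕ} {δ δ₁ δ₂ : ℕ → ℕ}

/-- The total delay accumulated in the hidden layers `V`. -/
def delay (δ : ℕ → ℕ) (V : Finset ℕ) : ℕ := ∑ j ∈ V, δ j

theorem IsDilationSchedule.exists_perm (h : IsDilationSchedule L δ) :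
    ∃ σ : Equiv.Perm ℕ, (∀ l < L, δ l = 2 ^ σ l) ∧ ∀ l < L, σ.symm l < L := by
  obtain ⟨σ, hσ⟩ := h
  have hval : ∀ l : Fin L, σ.viaEmbedding Fin.valEmbedding (l : ℕ) = σ l := fun l =>
    Equiv.Perm.viaEmbedding_apply σ Fin.valEmbedding l
  refine ⟨σ.viaEmbedding Fin.valEmbedding, fun l hl => ?_, fun l hl => ?_⟩
  · rw [hval ⟨l, hl⟩, ← hσ ⟨l, hl⟩]
  · have := hval (σ.symm ⟨l, hl⟩)
    rw [σ.apply_symm_apply] at this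
    exact (Equiv.symm_apply_eq _).2 this.symm ▸ (σ.symm ⟨l, hl⟩).2

/-- Different sets of layers have different delays, by uniqueness of binary expansions. -/
theorem IsDilationSchedule.delay_inj (h : IsDilationSchedule L δ) {V V' : Finset ℕ}
    (hV : V ⊆ Finset.range L) (hV' : V' ⊆ Finset.range L) : delay δ V = delay δ V' ↔ V = V' := by
  refine ⟨fun hVV' => ?_, fun h => h ▸ rfl⟩
  obtain ⟨σ, hσ, -⟩ := h.exists_perm
  have key : ∀ {V}, V ⊆ Finset.range L → delay δ V = ∑ i ∈ V.map σ.toEmbedding, 2 ^ i := by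
    intro V hV
    rw [Finset.sum_map]
    exact Finset.sum_congr rfl fun j hj => hσ j (Finset.mem_range.1 (hV hj))
  rw [key hV, key hV'] at hVV'
  exact Finset.map_injective _ (Finset.geomSum_injective le_rfl hVV')

theorem IsDilationSchedule.inj (h : IsDilationSchedule L δ) {i j : ℕ} (hi : i < L) (hj : j < L)
    (hij : δ i = δ j) : i = j := by
  have := (h.delay_inj (V := {i}) (V' := {j}) (by simpa using hi) (by simpa using hj)).1
    (by simpa [delay] using hij)
  simpa using this

/-- If `m` is the first layer in which two schedules differ, then the dilation of layer `m` of one of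
them is used by the other one in a later layer. -/
theorem exists_later_layer (h₁ : IsDilationSchedule L δ₁) (h₂ : IsDilationSchedule L δ₂) {m : ℕ}
    (hm : m < L) (hne : δ₁ m ≠ δ₂ m) (heq : ∀ j < m, δ₁ j = δ₂ j) :
    ∃ m', m < m' ∧ m' < L ∧ δ₁ m' = δ₂ m := by
  obtain ⟨σ₁, hσ₁, hσ₁'⟩ := h₁.exists_perm
  obtain ⟨σ, hσ⟩ := id h₂
  have hlt : σ₁.symm (σ ⟨m, hm⟩) < L := hσ₁' _ (σ ⟨m, hm⟩).2
  have hval : δ₁ (σ₁.symm (σ ⟨m, hm⟩)) = δ₂ m := by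
    rw [hσ₁ _ hlt, Equiv.apply_symm_apply, ← hσ ⟨m, hm⟩]
  refine ⟨_, ?_, hlt, hval⟩
  by_contra hle
  rcases eq_or_lt_of_le (not_lt.1 hle) with h | h
  · exact hne ((congrArg δ₁ h.symm).trans hval)
  · rw [heq _ h] at hval
    exact absurd (h₂.inj hlt hm hval) h.ne

end Schedule

/-! ### Ranks of functions realized by dilated networks -/

section NetworkRank

variable {L d : ℕ} {δ w : ℕ → ℕ}
  {a b : ∀ l, Fin (layerWidth d w (l + 1)) → Fin (layerWidth d w l) → ℝ}

theorem hiddenLayer_congr {x x' : ℤ → Fin d → ℝ} (l : ℕ) (t : ℤ)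
    (h : ∀ U ⊆ Finset.range l, x (t - delay δ U) = x' (t - delay δ U)) :
    hiddenLayer δ w a b x l t = hiddenLayer δ w a b x' l t := by
  induction l generalizing t with
  | zero => simpa [delay, hiddenLayer] using h ∅
  | succ l ih =>
    have h₁ := ih t fun U hU => h U (hU.trans (Finset.range_subset_range.2 l.le_succ))
    have h₂ := ih (t - δ l) fun U hU => by
      have hl : l ∉ U := fun hl => by simpa using hU hl
      have := h (insert l U) (by
        rw [Finset.range_add_one]
        exact Finset.insert_subset_insert l hU)
      simpa [delay, Finset.sum_insert hl, sub_sub] using this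
    funext γ
    simp only [hiddenLayer, dilatedConv, h₁, h₂]

/-- Consider inputs `x u v` whose values at the times read by hidden layer `m + 1` at time `0` depend
on `u` only, and whose values at the other times read by the network depend on `v` only. The matrix
of the corresponding outputs factors through the channels of that hidden layer. -/
theorem exists_factorization_of_mem_networkFunctions {F : (ℤ → Fin d → ℝ) → ℤ → ℝ}
    (hF : F ∈ networkFunctions L δ d w) {m : ℕ} (hm : m < L) {X Y : Type*} (u₀ : X) (v₀ : Y)
    (x : X → Y → ℤ → Fin d → ℝ)
    (hin : ∀ U ⊆ Finset.range (m + 1), ∀ u v v', x u v (-delay δ U) = x u v' (-delay δ U))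
    (hout : ∀ U ⊆ Finset.range L, ¬ U ⊆ Finset.range (m + 1) →
      ∀ u u' v, x u v (-delay δ U) = x u' v (-delay δ U)) :
    ∃ (H : X → Fin (w m) → ℝ) (G : Fin (w m) → Y → ℝ),
      ∀ u v, F (x u v) 0 = ∑ α, H u α * G α v := by
  obtain ⟨a, b, o, hF⟩ := hF
  have key : ∀ l, m + 1 ≤ l → l ≤ L →
      ∃ G : Fin (layerWidth d w l) → Fin (w m) → Y → ℝ, ∀ u v γ,
        hiddenLayer δ w a b (x u v) l 0 γ =
          ∑ α, hiddenLayer δ w a b (x u v) (m + 1) 0 α * G γ α v := by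
    intro l hl
    induction l, hl using Nat.le_induction with
    | base => exact fun _ => ⟨fun γ α _ => if α = γ then 1 else 0, by simp⟩
    | succ l hml ih =>
      intro hl
      obtain ⟨G, hG⟩ := ih (Nat.le_of_succ_le hl)
      -- the delayed tap of layer `l` reads only times that involve the dilation `δ l`
      have hfar : ∀ u v, hiddenLayer δ w a b (x u v) l (0 - δ l) =
          hiddenLayer δ w a b (x u₀ v) l (0 - δ l) := fun u v => by
        refine hiddenLayer_congr l _ fun U hU => ?_
        have hlU : l ∉ U := fun h => by simpa using hU h
        have := hout (insert l U)
          ((Finset.insert_subset_insert l hU).trans (by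
            rw [← Finset.range_add_one]
            exact Finset.range_subset_range.2 hl))
          (fun h => by
            have := Finset.mem_range.1 (h (Finset.mem_insert_self l U))
            omega) u u₀ v
        rw [delay, Finset.sum_insert hlU] at this
        rw [zero_sub, ← neg_add', ← Nat.cast_add]
        exact this
      refine ⟨fun γ α v => (∑ β, a l γ β * hiddenLayer δ w a b (x u₀ v) l (0 - δ l) β) *
        ∑ β, b l γ β * G β α v, fun u v γ => ?_⟩
      simp only [hiddenLayer, dilatedConv, hfar u v, hG u v]
      simp only [← mul_assoc, mul_comm _ (∑ β, a l γ β * _)]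
      simp only [mul_assoc]
      rw [← Finset.mul_sum]
      congr 1
      simp only [Finset.mul_sum]
      rw [Finset.sum_comm]
      exact Finset.sum_congr rfl fun _ _ => Finset.sum_congr rfl fun _ _ => by ring
  obtain ⟨G, hG⟩ := key L hm le_rfl
  have hnear : ∀ u v, hiddenLayer δ w a b (x u v₀) (m + 1) 0 =
      hiddenLayer δ w a b (x u v) (m + 1) 0 := fun u v =>
    hiddenLayer_congr (m + 1) 0 fun U hU => by
      rw [zero_sub]
      exact hin U hU u v₀ v
  refine ⟨fun u α => hiddenLayer δ w a b (x u v₀) (m + 1) 0 α,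
    fun α v => ∑ γ, o γ * G γ α v, fun u v => ?_⟩
  simp only [hF, hG, hnear u v, Finset.mul_sum]
  rw [Finset.sum_comm]
  exact Finset.sum_congr rfl fun _ _ => Finset.sum_congr rfl fun _ _ => by ring

end NetworkRank

/-! ### A dilated network that compares inputs -/

section Comparison

variable {d k : ℕ} {δ w : ℕ → ℕ}

/-- The input sequence whose value at time `t` is the unit vector of the channel `f (ι t)`. -/
def oneHot (f : Fin k ↪ Fin d) (ι : ℤ → Fin k) : ℤ → Fin d → ℝ :=
  fun t γ => if γ = f (ι t) then 1 else 0

/-- Weights for the delayed tap. The channels in use are those in the range of `f`; all other channels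
of the hidden layers vanish. Below layer `m` every channel in use receives the sum of all channels,
which is `1` for a one-hot sequence, so that the delayed tap has no influence. Layer `m` copies the
channels in use, and the layers above sum all channels into one. -/
def delayedWeight (f : ∀ l, Fin k ↪ Fin (layerWidth d w l)) (z : Fin k) (m l : ℕ)
    (γ : Fin (layerWidth d w (l + 1))) (α : Fin (layerWidth d w l)) : ℝ :=
  if l < m then if ∃ i, γ = f (l + 1) i then 1 else 0
  else if l = m then if ∃ i, γ = f (l + 1) i ∧ α = f l i then 1 else 0
  else if γ = f (l + 1) z then 1 else 0

/-- Weights for the undelayed tap: the layers up to layer `m` copy the channels in use, and the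
layers above sum all channels into one. -/
def currentWeight (f : ∀ l, Fin k ↪ Fin (layerWidth d w l)) (z : Fin k) (m l : ℕ)
    (γ : Fin (layerWidth d w (l + 1))) (α : Fin (layerWidth d w l)) : ℝ :=
  if l ≤ m then if ∃ i, γ = f (l + 1) i ∧ α = f l i then 1 else 0
  else if γ = f (l + 1) z then 1 else 0

theorem delayedWeight_eq_zero {f : ∀ l, Fin k ↪ Fin (layerWidth d w l)} {l : ℕ}
    {γ : Fin (layerWidth d w (l + 1))} (hγ : ∀ i, f (l + 1) i ≠ γ) (z : Fin k) (m : ℕ) :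
    delayedWeight f z m l γ = 0 := by
  funext α
  have h : ∀ i, γ ≠ f (l + 1) i := fun i => (hγ i).symm
  simp [delayedWeight, h]

variable (f : ∀ l, Fin k ↪ Fin (layerWidth d w l)) (z : Fin k) (m : ℕ) (ι : ℤ → Fin k)

/-- The comparison network, fed with a one-hot sequence. -/
local notation "layer" =>
  hiddenLayer δ w (delayedWeight f z m) (currentWeight f z m) (oneHot (f 0) ι)

theorem hiddenLayer_oneHot_of_le {l : ℕ} (hl : l ≤ m) (t : ℤ) (γ : Fin (layerWidth d w l)) :
    layer l t γ = if γ = f l (ι t) then 1 else 0 := by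
  induction l generalizing t with
  | zero => rfl
  | succ l ih =>
    have hlm : l < m := hl
    simp only [hiddenLayer, dilatedConv, ih hlm.le, mul_ite, mul_one, mul_zero, Finset.sum_ite_eq',
      Finset.mem_univ, if_true, delayedWeight, currentWeight, hlm, hlm.le, (f l).injective.eq_iff]
    by_cases hγ : γ = f (l + 1) (ι t)
    · simp [hγ]
    · simp [hγ]

theorem sum_hiddenLayer_oneHot (t : ℤ) :
    ∑ γ, layer (m + 1) t γ = if ι t = ι (t - δ m) then 1 else 0 := by
  have h : ∀ γ, layer (m + 1) t γ =
      if γ = f (m + 1) (ι t) then if ι t = ι (t - δ m) then 1 else 0 else 0 := by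
    intro γ
    have hs : ∀ t', (∃ i, γ = f (m + 1) i ∧ ι t' = i) ↔ γ = f (m + 1) (ι t') := fun t' =>
      ⟨fun ⟨i, hi, hti⟩ => hti ▸ hi, fun h => ⟨_, h, rfl⟩⟩
    simp only [hiddenLayer, dilatedConv, hiddenLayer_oneHot_of_le f z m ι le_rfl, mul_ite, mul_one,
      mul_zero, Finset.sum_ite_eq', Finset.mem_univ, if_true, delayedWeight, currentWeight,
      lt_irrefl, if_false, le_refl, (f m).injective.eq_iff, hs]
    by_cases h₁ : γ = f (m + 1) (ι t)
    · simp [h₁, (f (m + 1)).injective.eq_iff]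
    · simp [h₁]
  simp only [h, Finset.sum_ite_eq', Finset.mem_univ, if_true]

/-- Above layer `m`, the channel sums multiply the results of all comparisons in the receptive
field. -/
theorem sum_hiddenLayer_oneHot_eq_prod (n : ℕ) (t : ℤ) :
    ∑ γ, layer (m + 1 + n) t γ = ∏ U ∈ (Finset.range n).powerset,
      if ι (t - delay (fun j => δ (m + 1 + j)) U) =
        ι (t - delay (fun j => δ (m + 1 + j)) U - δ m) then (1 : ℝ) else 0 := by
  induction n generalizing t with
  | zero => simpa [delay] using sum_hiddenLayer_oneHot f z m ι t
  | succ n ih =>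
    have h : ∀ γ, layer (m + 1 + n + 1) t γ = if γ = f (m + 1 + n + 1) z then
        (∑ α, layer (m + 1 + n) (t - δ (m + 1 + n)) α) * ∑ α, layer (m + 1 + n) t α else 0 := by
      intro γ
      have h₁ : ¬ m + 1 + n < m := by omega
      have h₂ : m + 1 + n ≠ m := by omega
      have h₃ : ¬ m + 1 + n ≤ m := by omega
      rw [hiddenLayer]
      simp only [dilatedConv, delayedWeight, currentWeight, h₁, h₂, h₃, if_false]
      by_cases hγ : γ = f (m + 1 + n + 1) z <;> simp [hγ]
    rw [Finset.range_add_one, Finset.prod_powerset_insert Finset.notMem_range_self, ← ih t]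
    have hsum : ∑ γ, layer (m + 1 + (n + 1)) t γ = ∑ γ, layer (m + 1 + n + 1) t γ := rfl
    rw [hsum]
    simp only [h, Finset.sum_ite_eq', Finset.mem_univ, if_true]
    rw [mul_comm, ih (t - _)]
    congr 1
    refine Finset.prod_congr rfl fun U hU => ?_
    have hn : n ∉ U := fun h => Finset.notMem_range_self (Finset.mem_powerset.1 hU h)
    have : ((delay (fun j => δ (m + 1 + j)) (insert n U) : ℕ) : ℤ) =
        δ (m + 1 + n) + delay (fun j => δ (m + 1 + j)) U := by
      simp [delay, Finset.sum_insert hn]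
    rw [this, ← sub_sub]

end Comparison

/-! ### Test sequences -/

section TestSequence

variable {L d k : ℕ} {δ w : ℕ → ℕ}

/-- The sequence of indices that carries the two entries of `u` at the times `0` and `-P`, the two
entries of `v` at the times `-Q` and `-(P + Q)`, and `z` at all other times. -/
def testSeq (z : Fin k) (P Q : ℕ) (u v : Fin k × Fin k) : ℤ → Fin k := fun t =>
  if t = 0 then u.1 else if t = -(P : ℤ) then u.2 else if t = -(Q : ℤ) then v.1 else
    if t = -((P + Q : ℕ) : ℤ) then v.2 else z

theorem testSeq_swap (z : Fin k) {P Q : ℕ} (hPQ : P ≠ Q) (u v : Fin k × Fin k) :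
    testSeq z P Q u v = testSeq z Q P (u.1, v.1) (u.2, v.2) := by
  funext t
  unfold testSeq
  split_ifs <;> first | rfl | omega

variable {m m' : ℕ} {z : Fin k}

theorem IsDilationSchedule.testSeq_delay (h : IsDilationSchedule L δ) (hmm' : m < m') (hm' : m' < L)
    {U : Finset ℕ} (hU : U ⊆ Finset.range L) (u v : Fin k × Fin k) :
    testSeq z (δ m) (δ m') u v (-(delay δ U : ℤ)) =
      if U = ∅ then u.1 else if U = {m} then u.2 else if U = {m'} then v.1 else
        if U = {m, m'} then v.2 else z := by
  have h₁ : {m} ⊆ Finset.range L := by simpa using hmm'.trans hm'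
  have h₂ : {m'} ⊆ Finset.range L := by simpa using hm'
  have e₁ : δ m = delay δ {m} := by simp [delay]
  have e₂ : δ m' = delay δ {m'} := by simp [delay]
  have e₃ : δ m + δ m' = delay δ {m, m'} := by simp [delay, Finset.sum_pair hmm'.ne]
  have e₀ : (-(delay δ U : ℤ) = 0) ↔ delay δ U = delay δ ∅ := by
    rw [neg_eq_zero, Nat.cast_eq_zero, delay, delay, Finset.sum_empty]
  unfold testSeq
  rw [e₃, e₁, e₂]
  simp only [neg_inj, Nat.cast_inj, e₀, h.delay_inj hU (Finset.empty_subset _),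
    h.delay_inj hU h₁, h.delay_inj hU h₂,
    h.delay_inj hU (Finset.insert_subset (by simpa using hmm'.trans hm') h₂)]

/-- On a test sequence, all comparisons made by the comparison network compare `z` with itself, but
for the two comparisons within `u` and within `v`. -/
theorem IsDilationSchedule.sum_hiddenLayer_testSeq (h : IsDilationSchedule L δ) (hmm' : m < m')
    (hm' : m' < L) (f : ∀ l, Fin k ↪ Fin (layerWidth d w l)) (u v : Fin k × Fin k) :
    ∑ γ, hiddenLayer δ w (delayedWeight f z m) (currentWeight f z m)
        (oneHot (f 0) (testSeq z (δ m) (δ m') u v)) L 0 γ =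
      (if u.1 = u.2 then 1 else 0) * (if v.1 = v.2 then 1 else 0) := by
  obtain ⟨n, rfl⟩ := Nat.exists_eq_add_of_le (Nat.succ_le_of_lt (hmm'.trans hm'))
  obtain ⟨n', rfl⟩ := Nat.exists_eq_add_of_le (Nat.succ_le_of_lt hmm')
  rw [Nat.succ_eq_add_one] at *
  set g : ℕ ↪ ℕ := addLeftEmbedding (m + 1) with hg
  -- the times compared with each other are the delays of `U.map g` and of `insert m (U.map g)`
  have hmU : ∀ U : Finset ℕ, m ∉ U.map g := by
    intro U hU
    obtain ⟨j, -, hj⟩ := Finset.mem_map.1 hU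
    simp only [hg, addLeftEmbedding_apply] at hj
    omega
  have hval : ∀ U ∈ (Finset.range n).powerset, ∀ u v : Fin k × Fin k,
      (testSeq z (δ m) (δ (m + 1 + n')) u v (0 - delay (fun j => δ (m + 1 + j)) U) =
        if U = ∅ then u.1 else if U = {n'} then v.1 else z) ∧
      (testSeq z (δ m) (δ (m + 1 + n')) u v (0 - delay (fun j => δ (m + 1 + j)) U - δ m) =
        if U = ∅ then u.2 else if U = {n'} then v.2 else z) := by
    intro U hU u v
    have hsub : U.map g ⊆ Finset.range (m + 1 + n) := by
      intro i hi
      obtain ⟨j, hj, rfl⟩ := Finset.mem_map.1 hi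
      have := Finset.mem_range.1 (Finset.mem_powerset.1 hU hj)
      simp only [hg, addLeftEmbedding_apply, Finset.mem_range]
      omega
    have hsub' : insert m (U.map g) ⊆ Finset.range (m + 1 + n) :=
      Finset.insert_subset (Finset.mem_range.2 (by omega)) hsub
    have hd : delay (fun j => δ (m + 1 + j)) U = delay δ (U.map g) := by
      simp [delay, hg]
    have hd' : (0 : ℤ) - delay δ (U.map g) - δ m = -(delay δ (insert m (U.map g)) : ℕ) := by
      rw [delay, delay, Finset.sum_insert (hmU U)]
      push_cast
      ring
    have i₀ : U.map g = ∅ ↔ U = ∅ := Finset.map_eq_empty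
    have i₁ : U.map g = {m + 1 + n'} ↔ U = {n'} := by
      have : ({m + 1 + n'} : Finset ℕ) = ({n'} : Finset ℕ).map g := by simp [hg]
      rw [this, Finset.map_inj]
    have i₂ : U.map g ≠ {m} := fun h => hmU U (h ▸ Finset.mem_singleton_self m)
    have i₃ : U.map g ≠ {m, m + 1 + n'} := fun h => hmU U (h ▸ Finset.mem_insert_self m _)
    have hins : ∀ V, m ∉ V → (insert m (U.map g) = insert m V ↔ U.map g = V) := fun V hV =>
      ⟨fun h => by rw [← Finset.erase_insert (hmU U), h, Finset.erase_insert hV], fun h => h ▸ rfl⟩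
    have j₀ : insert m (U.map g) = {m} ↔ U = ∅ := by
      rw [← i₀, ← insert_empty_eq m]
      exact hins ∅ (Finset.notMem_empty m)
    have j₁ : insert m (U.map g) = {m, m + 1 + n'} ↔ U = {n'} := by
      rw [← i₁]
      exact hins {m + 1 + n'} (by
        rw [Finset.mem_singleton]
        omega)
    have j₂ : insert m (U.map g) ≠ {m + 1 + n'} := fun h => by
      have := h ▸ Finset.mem_insert_self m (U.map g)
      rw [Finset.mem_singleton] at this
      omega
    rw [hd, hd', zero_sub, h.testSeq_delay hmm' hm' hsub, h.testSeq_delay hmm' hm' hsub']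
    simp only [i₀, i₁, i₂, i₃, j₀, j₁, j₂, Finset.insert_ne_empty, if_false, and_self]
  have hn' : n' < n := by omega
  rw [sum_hiddenLayer_oneHot_eq_prod]
  rw [Finset.prod_congr rfl fun U hU => by rw [(hval U hU u v).1, (hval U hU u v).2]]
  rw [Finset.prod_eq_mul ∅ {n'} (Finset.singleton_ne_empty n').symm]
  · simp
  · rintro U - ⟨h₁, h₂⟩
    simp [h₁, h₂]
  · simp
  · intro h
    exact absurd (Finset.mem_powerset.2 (Finset.singleton_subset_iff.2 (Finset.mem_range.2 hn'))) h

/-- The times read by hidden layer `m + 1` at time `0` include `0` and `-δ m`, but neither `-δ m'` nor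
`-(δ m + δ m')`, so on a test sequence this layer sees `u`, but not `v`. -/
theorem IsDilationSchedule.mul_self_le_width (h : IsDilationSchedule L δ) (hmm' : m < m')
    (hm' : m' < L) (f : Fin k ↪ Fin d) {F : (ℤ → Fin d → ℝ) → ℤ → ℝ}
    (hval : ∀ u v, F (oneHot f (testSeq z (δ m) (δ m') u v)) 0 =
      (if u.1 = u.2 then 1 else 0) * (if v.1 = v.2 then 1 else 0) +
        (if u.1 = v.1 then 1 else 0) * (if u.2 = v.2 then 1 else 0))
    (hF : F ∈ networkFunctions L δ d w) : k * k ≤ ∑ l ∈ Finset.range L, w l := by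
  have hm : m < L := hmm'.trans hm'
  obtain ⟨H, G, hHG⟩ := exists_factorization_of_mem_networkFunctions hF hm (z, z) (z, z)
    (fun u v => oneHot f (testSeq z (δ m) (δ m') u v))
    (by
      intro U hU u v v'
      have hm'U : m' ∉ U := fun h => by
        have := Finset.mem_range.1 (hU h)
        omega
      have h₁ : U ≠ {m'} := fun h => hm'U (by simp [h])
      have h₂ : U ≠ {m, m'} := fun h => hm'U (by simp [h])
      have hUL : U ⊆ Finset.range L := hU.trans (Finset.range_subset_range.2 hm)
      funext γ
      simp only [oneHot, h.testSeq_delay hmm' hm' hUL, h₁, h₂, if_false])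
    (by
      intro U hUL hU u u' v
      have h₁ : U ≠ ∅ := fun h => hU (by simp [h])
      have h₂ : U ≠ {m} := fun h => hU (by simp [h])
      funext γ
      simp only [oneHot, h.testSeq_delay hmm' hm' hUL, h₁, h₂, if_false])
  refine (mul_self_le_of_factorization H G fun u v => ?_).trans
    (Finset.single_le_sum (f := w) (fun _ _ => Nat.zero_le _) (Finset.mem_range.2 hm))
  rw [← hHG, hval]

end TestSequence

/-! ### Interconnected networks without exchange -/

section MixedNetwork

/-- When the exchanged channels all vanish, interconnected networks run independently. -/
theorem mixedLayer_eq {d r : ℕ} {δ₁ δ₂ : ℕ → ℕ} {E : ℕ → Finset (Fin r)}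
    {a₁ b₁ a₂ b₂ : ∀ l, Fin r → Fin (layerWidth d (fun _ => r) l) → ℝ}
    (h₁ : ∀ l, ∀ γ ∈ E l, a₁ l γ = 0) (h₂ : ∀ l, ∀ γ ∈ E l, a₂ l γ = 0) (x : ℤ → Fin d → ℝ)
    (l : ℕ) : mixedLayer δ₁ δ₂ E a₁ b₁ a₂ b₂ x l =
      (hiddenLayer δ₁ (fun _ => r) a₁ b₁ x l, hiddenLayer δ₂ (fun _ => r) a₂ b₂ x l) := by
  induction l with
  | zero => rfl
  | succ l ih =>
    rw [mixedLayer, ih]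
    refine Prod.ext ?_ ?_ <;> funext t γ <;> by_cases hγ : γ ∈ E l
    all_goals simp [hiddenLayer, dilatedConv, hγ, h₁, h₂]

theorem exists_mixedNetwork_width_lower_bound (L : ℕ) : ∃ c : ℝ, 0 < c ∧
    ∀ δ₁ δ₂ : ℕ → ℕ, IsDilationSchedule L δ₁ → IsDilationSchedule L δ₂ →
    (∃ l < L, δ₁ l ≠ δ₂ l) →
    ∀ (r d : ℕ), r ≤ d →
    ∀ E : ℕ → Finset (Fin r), (∀ l, 2 * (E l).card ≤ r) →
    ∃ F ∈ mixedNetworkFunctions L δ₁ δ₂ d r E,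
      ∀ δ ∈ ({δ₁, δ₂} : Set (ℕ → ℕ)), ∀ w : ℕ → ℕ,
        F ∈ networkFunctions L δ d w →
        c * ((2 * L * r : ℕ) : ℝ) ^ 2 ≤ ((∑ l ∈ Finset.range L, w l : ℕ) : ℝ) := by
  refine ⟨1 / (4 * L + 1) ^ 2, by positivity, fun δ₁ δ₂ h₁ h₂ hne r d hrd E hE => ?_⟩
  rcases Nat.eq_zero_or_pos r with rfl | hr
  · exact ⟨_, ⟨0, 0, 0, 0, 0, 0, fun _ _ => rfl⟩, fun δ _ w _ => by simp; positivity⟩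
  classical
  obtain ⟨m, ⟨hm, hmne⟩, hmin⟩ : ∃ m, (m < L ∧ δ₁ m ≠ δ₂ m) ∧ ∀ j < m, δ₁ j = δ₂ j := by
    refine ⟨Nat.find hne, Nat.find_spec hne, fun j hj => ?_⟩
    by_contra hj'
    exact Nat.find_min hne hj ⟨hj.trans (Nat.find_spec hne).1, hj'⟩
  obtain ⟨m₁, hm₁, hm₁L, hδ₁⟩ := exists_later_layer h₁ h₂ hm hmne hmin
  obtain ⟨m₂, hm₂, hm₂L, hδ₂⟩ := exists_later_layer h₂ h₁ hm hmne.symm fun j hj => (hmin j hj).symm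
  obtain ⟨k, hk₁, hk₂⟩ : ∃ k, 2 * k ≤ r + 1 ∧ r ≤ 2 * k := ⟨(r + 1) / 2, by omega, by omega⟩
  have hk : 0 < k := by omega
  let z : Fin k := ⟨0, hk⟩
  choose g hg using fun l => exists_embedding_avoiding (hE l) hk₁
  let f : ∀ l, Fin k ↪ Fin (layerWidth d (fun _ => r) l) := fun l => match l with
    | 0 => Fin.castLEEmb (show k ≤ d by omega)
    | l + 1 => g l
  have hvanish : ∀ l, ∀ γ ∈ E l, delayedWeight f z m l γ = 0 := fun l γ hγ =>
    by
    refine delayedWeight_eq_zero (f := f) (fun i (hi : g l i = γ) => hg l i ?_) z m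
    rwa [hi]
  let a : ∀ l, Fin r → Fin (layerWidth d (fun _ => r) l) → ℝ := delayedWeight f z m
  let b : ∀ l, Fin r → Fin (layerWidth d (fun _ => r) l) → ℝ := currentWeight f z m
  let F : (ℤ → Fin d → ℝ) → ℤ → ℝ := fun x t =>
    ∑ γ, 1 * (mixedLayer δ₁ δ₂ E a b a b x L).1 t γ +
      ∑ γ, 1 * (mixedLayer δ₁ δ₂ E a b a b x L).2 t γ
  have hF : ∀ u v, F (oneHot (f 0) (testSeq z (δ₁ m) (δ₁ m₁) u v)) 0 =
      (if u.1 = u.2 then 1 else 0) * (if v.1 = v.2 then 1 else 0) +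
        (if u.1 = v.1 then 1 else 0) * (if u.2 = v.2 then 1 else 0) := by
    intro u v
    simp only [F, mixedLayer_eq hvanish hvanish, a, b, one_mul]
    rw [h₁.sum_hiddenLayer_testSeq hm₁ hm₁L f u v, hδ₁, testSeq_swap z hmne, ← hδ₂,
      h₂.sum_hiddenLayer_testSeq hm₂ hm₂L f]
  refine ⟨F, ⟨a, b, a, b, fun _ => 1, fun _ => 1, fun _ _ => rfl⟩, fun δ hδ w hFδ => ?_⟩
  have hsize : k * k ≤ ∑ l ∈ Finset.range L, w l := by
    rcases hδ with rfl | rfl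
    · exact h₁.mul_self_le_width hm₁ hm₁L (f 0) hF hFδ
    · refine h₂.mul_self_le_width (z := z) hm₂ hm₂L (f 0) (fun u v => ?_) hFδ
      rw [testSeq_swap z (hδ₂ ▸ hmne.symm), hδ₂, ← hδ₁, hF, add_comm]
  have h₃ : ((2 * L * r : ℕ) : ℝ) ≤ (4 * L + 1) * k := by
    have : 2 * L * r ≤ (4 * L + 1) * k := by nlinarith
    exact_mod_cast this
  have h₄ : ((k * k : ℕ) : ℝ) ≤ (∑ l ∈ Finset.range L, w l : ℕ) := by exact_mod_cast hsize
  refine le_trans ?_ h₄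
  rw [one_div, inv_mul_le_iff₀ (by positivity)]
  calc ((2 * L * r : ℕ) : ℝ) ^ 2 ≤ ((4 * L + 1) * k) ^ 2 := by gcongr
    _ = (4 * L + 1) ^ 2 * ((k * k : ℕ) : ℝ) := by push_cast; ring

end MixedNetwork

theorem mainTheorem6 :
    (∀ N : ℕ, ∃ c : ℝ, 0 < c ∧
      ∀ T₁ T₂ : ModeTree N, T₁.bipartitions ≠ T₂.bipartitions →
      ∀ (r M : ℕ), r ≤ M →
      ∀ E : Finset (Fin N) → Finset (Fin r), (∀ ν, 2 * (E ν).card ≤ r) →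
      ∃ A ∈ mixedTensors T₁ T₂ r E M,
        ∀ T ∈ ({T₁, T₂} : Set (ModeTree N)), ∀ s : Finset (Fin N) → ℕ,
          A ∈ treeTensors T s M →
          c * (mixedSize T₁ T₂ r : ℝ) ^ 2 ≤ (treeSize T s : ℝ)) ∧
    (∀ L : ℕ, ∃ c : ℝ, 0 < c ∧
      ∀ δ₁ δ₂ : ℕ → ℕ, IsDilationSchedule L δ₁ → IsDilationSchedule L δ₂ →
      (∃ l < L, δ₁ l ≠ δ₂ l) →
      ∀ (r d : ℕ), r ≤ d →
      ∀ E : ℕ → Finset (Fin r), (∀ l, 2 * (E l).card ≤ r) →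
      ∃ F ∈ mixedNetworkFunctions L δ₁ δ₂ d r E,
        ∀ δ ∈ ({δ₁, δ₂} : Set (ℕ → ℕ)), ∀ w : ℕ → ℕ,
          F ∈ networkFunctions L δ d w →
          c * ((2 * L * r : ℕ) : ℝ) ^ 2 ≤ ((∑ l ∈ Finset.range L, w l : ℕ) : ℝ)) :=
  ⟨exists_mixedTensor_treeSize_lower_bound, exists_mixedNetwork_width_lower_bound⟩
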